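/- Let $n>k\ge r\ge 1$ be integers and put $k_1=\lceil k/r\rceil$, $k_2=k_1r-k$, $n_1=\lceil n/(r+1)\rceil$, $n_2=n_1(r+1)-n$ and $d^*=n-k-\lceil k/r\rceil+2$. An $(n,k,r)$-LRC is a $k$-dimensional linear code $C\subseteq\mathbb F^n$ over a finite field $\mathbb F$ such that every coordinate is, on $C$, a linear combination of at most $r$ other coordinates; its minimum distance is the least Hamming distance between two distinct codewords; $\mathscr D(n,k,r)$ is the largest minimum distance of an $(n,k,r)$-LRC over any finite field, and an $(n,k,r)$-LRC is optimal if its minimum distance is $d^*$. Multigraphs are loopless; call a multigraph good if it has $n_1$ vertices and $n_2$ edges and no subgraph with exactly $k_1$ vertices and more than $k_2$ edges. Assume $k_1\le n_1$ (this holds whenever an $(n,k,r)$-LRC exists). (1) $\mathscr D(n,k,r)$ exists and equals $d^*$ if and only if a good multigraph exists. (2) Let $G$ be a good multigraph. Call a bipartite graph $T$ between $n-k$ check nodes and $n$ variable nodes a full Tanner graph of $G$ if the vertices of $G$ can be identified with distinct check nodes (the local ones) and the edges of $G$ with distinct variable nodes so that: an edge of $G$ is adjacent, among the local check nodes, exactly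 to its two ends; every other variable node is adjacent to exactly one local check node; every local check node has degree $r+1$; and every non-local check node is adjacent to all $n$ variable nodes. Then $G$ has a full Tanner graph, and for every full Tanner graph $T$ of $G$ the following holds. For a finite field $\mathbb F_q$ choose an $(n-k)\times n$ matrix $H$ whose entries at the edges of $T$ are independent and uniform in $\mathbb F_q\setminus\{0\}$ and whose other entries are $0$. (a) For every $q$, the code with parity-check matrix $H$ is an optimal $(n,k,r)$-LRC with probability at least $1-n^{d^*-1}/q$; so the probability is at least $1-\varepsilon$ if $q\ge n^{d^*-1}/\varepsilon$, and at least $1-1/n$ if $q\ge n^{d^*}$. (b) There is a finite field of order $q\le 2n^{d^*}$ over which this probability is at least $1-1/n$, and over which some matrix, nonzero exactly at the edges of $T$, is the parity-check matrix of an optimal $(n,k,r)$-LRC. -/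

import Mathlib

/-! ## Parameters -/

/-- `k₁ = ⌈k / r⌉`. -/
def kOne (k r : ℕ) : ℕ := k ⌈/⌉ r

/-- `k₂ = k₁ r - k` (the subtraction does not truncate for `r ≥ 1`). -/
def kTwo (k r : ℕ) : ℕ := kOne k r * r - k

/-- `n₁ = ⌈n / (r + 1)⌉`. -/
def nOne (n r : ℕ) : ℕ := n ⌈/⌉ (r + 1)

/-- `n₂ = n₁ (r + 1) - n` (the subtraction does not truncate). -/
def nTwo (n r : ℕ) : ℕ := nOne n r * (r + 1) - n

/-- `d* = n - k - ⌈k / r⌉ + 2`, an integer. -/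
def dStar (n k r : ℕ) : ℤ := (n : ℤ) - k - kOne k r + 2

/-! ## Locally recoverable codes -/

section Codes

variable {F : Type*} [Field F] {n : ℕ}

/-- `C` is an `(n, k, r)`-LRC: a linear code of length `n` and dimension `k` such that every
coordinate is, on `C`, a linear combination of at most `r` other coordinates. -/
def IsLRC (k r : ℕ) (C : Submodule F (Fin n → F)) : Prop :=
  Module.finrank F C = k ∧
    ∀ i : Fin n, ∃ S : Finset (Fin n), i ∉ S ∧ S.card ≤ r ∧
      ∃ a : Fin n → F, ∀ c ∈ C, c i = ∑ j ∈ S, a j * c j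

open Classical in
/-- `d` is the minimum distance of `C`: the least Hamming distance between two distinct
codewords. -/
def HasMinDist (C : Submodule F (Fin n → F)) (d : ℕ) : Prop :=
  IsLeast {w : ℕ | ∃ x ∈ C, ∃ y ∈ C, x ≠ y ∧ hammingDist x y = w} d

/-- `C` is an optimal `(n, k, r)`-LRC: its minimum distance is `d*`. -/
def IsOptimalLRC (k r : ℕ) (C : Submodule F (Fin n → F)) : Prop :=
  IsLRC k r C ∧ ∃ d : ℕ, HasMinDist C d ∧ (d : ℤ) = dStar n k r

end Codes

/-- The set of minimum distances of all `(n, k, r)`-LRCs over all finite fields. Its greatest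
element is `𝒟(n, k, r)`. -/
def lrcMinDists (n k r : ℕ) : Set ℤ :=
  {d | ∃ (F : Type) (_ : Field F) (_ : Finite F) (C : Submodule F (Fin n → F)) (δ : ℕ),
    IsLRC k r C ∧ HasMinDist C δ ∧ (δ : ℤ) = d}

/-! ## Multigraphs -/

/-- `G` is a loopless multigraph of order `n₁` and size `n₂` that has no subgraph of order `k₁`
and size greater than `k₂`. -/
def IsGoodMultigraph (n k r : ℕ) {α β : Type*} (G : Graph α β) : Prop :=
  G.Loopless ∧ G.vertexSet.encard = nOne n r ∧ G.edgeSet.encard = nTwo n r ∧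
    ¬ ∃ H : Graph α β, H ≤ G ∧ H.vertexSet.encard = kOne k r ∧
      (kTwo k r : ℕ∞) < H.edgeSet.encard

/-! ## From a multigraph to parity-check matrices -/

/-- The bipartite graph `T` between `n - k` check nodes and `n` variable nodes is a full Tanner
graph of the multigraph `G`: the vertices of `G` are (distinct) check nodes, called local, and the
edges of `G` are (distinct) variable nodes, each adjacent to exactly those local check nodes that
are its ends; every other variable node is adjacent to exactly one local check node, in such a way
that each local check node has degree `r + 1`; the remaining check nodes are adjacent to all
variable nodes. -/
def IsFullTannerGraphOf {n k : ℕ} (r : ℕ) {α β : Type*} (G : Graph α β)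
    (T : Fin (n - k) → Fin n → Prop) : Prop :=
  ∃ (check : G.vertexSet ↪ Fin (n - k)) (var : G.edgeSet ↪ Fin n),
    (∀ v e, T (check v) (var e) ↔ G.Inc e.1 v.1) ∧
    (∀ i, i ∉ Set.range var → ∃! v, T (check v) i) ∧
    (∀ v, {i | T (check v) i}.ncard = r + 1) ∧
    (∀ j, j ∉ Set.range check → ∀ i, T j i)

/-- The matrices over `F` whose nonzero positions are exactly the edges of `T`. -/
def matricesOn {n m : ℕ} (F : Type*) [Field F] (T : Fin m → Fin n → Prop) :
    Set (Matrix (Fin m) (Fin n) F) :=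
  {H | ∀ j i, H j i ≠ 0 ↔ T j i}

/-- The linear code with parity-check matrix `H`. -/
def codeOf {n m : ℕ} {F : Type*} [Field F] (H : Matrix (Fin m) (Fin n) F) :
    Submodule F (Fin n → F) :=
  LinearMap.ker H.mulVecLin

/-- The probability that an `(n - k) × n` matrix over the finite field `F` is the parity-check
matrix of an optimal `(n, k, r)`-LRC, when its entries at the edges of `T` are independent and
uniform among the nonzero elements of `F` (so that the matrix is uniform on the finite set
`matricesOn F T`) and its other entries are zero. -/
noncomputable def probOptimal {n : ℕ} (k r : ℕ) (F : Type*) [Field F]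
    (T : Fin (n - k) → Fin n → Prop) : ℝ :=
  ({H ∈ matricesOn F T | IsOptimalLRC k r (codeOf H)}.ncard : ℝ) / (matricesOn F T).ncard

/-!
The vertices of the multigraph are local parity checks of weight `r + 1`, and its edges are the
overlaps of their supports.

*From codes to multigraphs.* Let `C` be an `(n, k, r)`-LRC of minimum distance `d`. Dual codewords
of weight at most `r + 1` cover all coordinates, so at least `n₁` of them are independent
(`IsLRC.exists_local_checks`). Any `a > n - d` coordinates determine `C`, hence `m` independent
checks living on `a` coordinates force `k + m ≤ a` (`finrank_add_le_card_of_checks`). With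
`m = k₁ - 1` this is the Singleton-like bound `d ≤ d*` (`IsLRC.singleton_bound`). If `d = d*`, then
with `m = k₁` it says that the supports of any `k₁` local checks cover at least
`k + k₁ = k₁ (r + 1) - k₂` coordinates, that is, overlap in at most `k₂` places. Recording each
overlap as an edge gives a good multigraph (`exists_good_of_sets`); it has enough edges because
`n₁` sets of size `r + 1` inside `n` coordinates overlap in at least `n₂` places.

*From multigraphs to codes.* In a full Tanner graph of a good multigraph, any `d* - 1` variable
nodes satisfy Hall's condition (`IsGoodMultigraph.card_le_card_neighbors`), because a set `W` of
at least `k₁` vertices spans at most `|W| r - k` edges. So every `d* - 1` columns contain a minor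
with a matching, which is singular with probability at most `(d* - 2) / (q - 1)`
(`ncard_det_eq_zero_mul_le`). If no such minor vanishes, the distance is at least `d*` and the
dimension at least `k`; the Singleton-like bound, applied with the actual dimension, turns both
into equalities (`IsFullTannerGraphOf.isOptimalLRC`). A union bound over the column sets gives the
probability estimate, and Bertrand's postulate the field.
-/

/-! ### The parameters -/

section Params

variable {n k r : ℕ}

lemma le_nOne_mul (n r : ℕ) : n ≤ (r + 1) * nOne n r :=
  (ceilDiv_le_iff_le_mul (by omega)).1 le_rfl

lemma le_kOne_mul (hr : 1 ≤ r) : k ≤ r * kOne k r :=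
  (ceilDiv_le_iff_le_mul (by omega)).1 le_rfl

lemma kOne_mul_lt (hr : 1 ≤ r) : kOne k r * r < k + r := by
  rw [kOne, Nat.ceilDiv_eq_add_pred_div]
  have := Nat.div_mul_le_self (k + r - 1) r
  omega

lemma nOne_mul_lt (n r : ℕ) : nOne n r * (r + 1) < n + (r + 1) := by
  rw [nOne, Nat.ceilDiv_eq_add_pred_div]
  have := Nat.div_mul_le_self (n + (r + 1) - 1) (r + 1)
  omega

lemma kOne_mono {K : ℕ} (hr : 1 ≤ r) (h : k ≤ K) : kOne k r ≤ kOne K r := by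
  rw [kOne, ceilDiv_le_iff_le_mul (by omega)]
  exact h.trans (le_kOne_mul hr)

lemma add_kTwo (hr : 1 ≤ r) : k + kTwo k r = kOne k r * r := by
  have h := le_kOne_mul (k := k) hr
  rw [mul_comm] at h
  rw [kTwo]; omega

lemma add_nTwo : n + nTwo n r = nOne n r * (r + 1) := by
  have h := le_nOne_mul n r
  rw [mul_comm] at h
  rw [nTwo]; omega

lemma nTwo_le : nTwo n r ≤ r := by
  have := nOne_mul_lt n r
  have := add_nTwo (n := n) (r := r)
  omega

/-- There are enough check nodes for the `n₁` local ones. For `k₁ < n₁` this follows from `n₂ ≤ r`;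
for `k₁ = n₁` it amounts to `n₂ ≤ k₂`. -/
lemma nOne_add_le (hr : 1 ≤ r) (hk₁ : kOne k r ≤ nOne n r)
    (h : kOne k r = nOne n r → nTwo n r ≤ kTwo k r) : nOne n r + k ≤ n := by
  obtain ⟨m, hm⟩ := Nat.exists_eq_add_of_le hk₁
  have h1 := add_kTwo (k := k) hr
  have h2 := add_nTwo (n := n) (r := r)
  have h3 := nTwo_le (n := n) (r := r)
  rw [hm] at h h2 ⊢
  rcases Nat.eq_zero_or_pos m with rfl | hpos
  · have := h (by simp)
    rw [add_zero, mul_add] at h2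
    omega
  · have h4 : r ≤ m * r := Nat.le_mul_of_pos_left _ hpos
    have h5 : (kOne k r + m) * (r + 1) = kOne k r * r + m * r + kOne k r + m := by ring
    omega

end Params

/-! ### Dual codewords and the Singleton-like bound -/

section Dual

variable {F : Type*} [Field F] {n : ℕ}

open Classical in
/-- If a code has `m` independent parity checks supported on `A`, and no nonzero codeword vanishes
on `A`, then restricting to `A` loses nothing and the checks cut the dimension down to
`|A| - m`. -/
lemma finrank_add_le_card_of_checks (C : Submodule F (Fin n → F)) {m : ℕ}
    (h : Fin m → Fin n → F) (hli : LinearIndependent F h) (hC : ∀ v, ∀ c ∈ C, h v ⬝ᵥ c = 0)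
    (A : Finset (Fin n)) (hA : ∀ v i, h v i ≠ 0 → i ∈ A)
    (hinj : ∀ c ∈ C, (∀ i ∈ A, c i = 0) → c = 0) :
    Module.finrank F C + m ≤ A.card := by
  let M : Matrix (Fin m) (Fin n) F := h
  let E : Submodule F (Fin n → F) :=
    LinearMap.ker (LinearMap.funLeft F F (Subtype.val : A → Fin n))
  have hE : ∀ x : Fin n → F, x ∈ E ↔ ∀ i ∈ A, x i = 0 := fun x => by
    rw [LinearMap.mem_ker, funext_iff]
    exact Subtype.forall
  have hCK : C ≤ LinearMap.ker M.mulVecLin := fun c hc => by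
    rw [LinearMap.mem_ker]; ext v; exact hC v c hc
  have hEK : E ≤ LinearMap.ker M.mulVecLin := fun x hx => by
    rw [LinearMap.mem_ker]; ext v
    change ∑ i, h v i * x i = 0
    refine Finset.sum_eq_zero fun i _ => ?_
    by_cases hi : h v i = 0
    · simp [hi]
    · simp [(hE x).1 hx i (hA v i hi)]
  have hdisj : C ⊓ E = ⊥ := by
    rw [eq_bot_iff]
    rintro x ⟨hx, hx'⟩
    exact (Submodule.mem_bot F).2 (hinj x hx ((hE x).1 hx'))
  have h1 := Submodule.finrank_sup_add_finrank_inf_eq C E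
  have h2 := Submodule.finrank_mono (sup_le hCK hEK)
  have h3 := LinearMap.finrank_range_add_finrank_ker M.mulVecLin
  have h4 : Module.finrank F (LinearMap.range M.mulVecLin) = m := by
    have : M.rank = Fintype.card (Fin m) := LinearIndependent.rank_matrix hli
    simpa [Matrix.rank] using this
  have h5 := LinearMap.finrank_range_add_finrank_ker
    (LinearMap.funLeft F F (Subtype.val : A → Fin n))
  have h6 := Submodule.finrank_le
    (LinearMap.range (LinearMap.funLeft F F (Subtype.val : A → Fin n)))
  rw [hdisj, finrank_bot] at h1
  simp only [Module.finrank_fintype_fun_eq_card, Fintype.card_coe]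
    at h3 h5 h6
  change _ + Module.finrank F E = _ at h5
  omega

open Classical in
/-- A code of minimum distance `d` is determined by any `n - d + 1` coordinates. -/
lemma eq_zero_of_hasMinDist {C : Submodule F (Fin n → F)} {d : ℕ} (hd : HasMinDist C d)
    {A : Finset (Fin n)} (hA : n < A.card + d) {c : Fin n → F} (hc : c ∈ C)
    (h0 : ∀ i ∈ A, c i = 0) : c = 0 := by
  by_contra hne
  have h1 : d ≤ hammingNorm c := hd.2 ⟨c, hc, 0, C.zero_mem, hne, by simp⟩
  have h2 : hammingNorm c ≤ Aᶜ.card := by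
    refine Finset.card_le_card fun i hi => ?_
    rw [Finset.mem_compl]
    intro hiA
    simp [h0 i hiA] at hi
  rw [Finset.card_compl, Fintype.card_fin] at h2
  have := Finset.card_le_univ A
  rw [Fintype.card_fin] at this
  omega

open Classical in
lemma HasMinDist.pos {C : Submodule F (Fin n → F)} {d : ℕ} (hd : HasMinDist C d) : 0 < d := by
  obtain ⟨x, -, y, -, hxy, h⟩ := hd.1
  rw [← h]
  exact hammingDist_pos.2 hxy

open Classical in
/-- A locally recoverable code has `n₁` independent parity checks of weight at most `r + 1`: the
supports of a maximal independent family of such checks cover all coordinates. -/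
lemma IsLRC.exists_local_checks {k r : ℕ} {C : Submodule F (Fin n → F)} (hC : IsLRC k r C) :
    ∃ h : Fin (nOne n r) → Fin n → F, LinearIndependent F h ∧
      (∀ v, ∀ c ∈ C, h v ⬝ᵥ c = 0) ∧ ∀ v, (Finset.univ.filter fun i => h v i ≠ 0).card ≤ r + 1 := by
  have key : ∀ i : Fin n, ∃ g : Fin n → F, g i ≠ 0 ∧ (∀ c ∈ C, g ⬝ᵥ c = 0) ∧
      (Finset.univ.filter fun i => g i ≠ 0).card ≤ r + 1 := by
    intro i
    obtain ⟨S, hiS, hS, a, ha⟩ := hC.2 i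
    refine ⟨fun j => (if j = i then 1 else 0) - if j ∈ S then a j else 0, by simp [hiS], ?_, ?_⟩
    · intro c hc
      simp only [dotProduct, sub_mul, ite_mul, one_mul, zero_mul, Finset.sum_sub_distrib,
        Finset.sum_ite_eq', Finset.mem_univ, if_true, Finset.sum_ite_mem, Finset.univ_inter]
      rw [ha c hc, sub_self]
    · refine (Finset.card_le_card (t := insert i S) fun j hj => ?_).trans
        ((Finset.card_insert_le _ _).trans (by omega))
      rw [Finset.mem_insert]
      by_contra hcon
      push Not at hcon
      simp [hcon.1, hcon.2] at hj
  choose g hg1 hg2 hg3 using key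
  obtain ⟨b, hbs, hspan, hli⟩ := exists_linearIndependent F (Set.range g)
  have hbfin : b.Finite := (Set.finite_range g).subset hbs
  have hcover : ∀ i, ∃ x ∈ b, x i ≠ 0 := by
    intro i
    by_contra! hcon
    have h1 : Submodule.span F b ≤ LinearMap.ker (LinearMap.proj (R := F) (φ := fun _ => F) i) :=
      Submodule.span_le.2 fun x hx => hcon x hx
    exact hg1 i (h1 (hspan ▸ Submodule.subset_span ⟨i, rfl⟩))
  have hcard : nOne n r ≤ hbfin.toFinset.card := by
    rw [nOne, ceilDiv_le_iff_le_mul (by omega)]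
    calc n = (Finset.univ : Finset (Fin n)).card := by simp
      _ ≤ (hbfin.toFinset.biUnion fun x => Finset.univ.filter fun i => x i ≠ 0).card := by
        refine Finset.card_le_card fun i _ => ?_
        obtain ⟨x, hx, hxi⟩ := hcover i
        simp only [Finset.mem_biUnion, Set.Finite.mem_toFinset, Finset.mem_filter,
          Finset.mem_univ, true_and]
        exact ⟨x, hx, hxi⟩
      _ ≤ hbfin.toFinset.card * (r + 1) := by
        refine Finset.card_biUnion_le_card_mul _ _ _ fun x hx => ?_
        obtain ⟨i, rfl⟩ := hbs (hbfin.mem_toFinset.1 hx)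
        exact hg3 i
      _ = _ := mul_comm _ _
  have : Fintype b := hbfin.fintype
  have hcard' : Fintype.card (Fin (nOne n r)) ≤ Fintype.card b := by
    rw [Fintype.card_fin, ← Set.toFinset_card]
    convert hcard using 2
    ext; simp
  obtain ⟨φ⟩ := Function.Embedding.nonempty_of_card_le hcard'
  refine ⟨fun v => (φ v : Fin n → F), hli.comp φ φ.injective, fun v => ?_, fun v => ?_⟩
  · obtain ⟨i, hi⟩ := hbs (φ v).2
    simp only [← hi]; exact hg2 i
  · obtain ⟨i, hi⟩ := hbs (φ v).2
    simp only [← hi]; exact hg3 i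

/-- The local checks alone bound the dimension, so that `⌈k / r⌉ ≤ n₁` for every code with
locality `r`. -/
lemma IsLRC.dim_add_nOne_le {k r : ℕ} {C : Submodule F (Fin n → F)} (hC : IsLRC k r C) :
    k + nOne n r ≤ n := by
  obtain ⟨h, hli, hh, -⟩ := hC.exists_local_checks
  have := finrank_add_le_card_of_checks C h hli hh Finset.univ (by simp)
    (fun c _ h0 => funext fun i => h0 i (Finset.mem_univ i))
  rwa [hC.1, Finset.card_univ, Fintype.card_fin] at this

lemma IsLRC.kOne_le_nOne {k r : ℕ} (hr : 1 ≤ r) {C : Submodule F (Fin n → F)}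
    (hC : IsLRC k r C) : kOne k r ≤ nOne n r := by
  rw [kOne, ceilDiv_le_iff_le_mul (by omega)]
  have h1 := hC.dim_add_nOne_le
  have h2 := le_nOne_mul n r
  rw [add_mul, one_mul] at h2
  omega

open Classical in
/-- If `m` independent checks live on at most `a` coordinates, where `n - d < a ≤ n`, then
`k + m ≤ a`: any `a` coordinates determine the code. -/
lemma IsLRC.dim_add_le_of_subset {k r d : ℕ} {C : Submodule F (Fin n → F)} (hC : IsLRC k r C)
    (hd : HasMinDist C d) {m : ℕ} (h : Fin m → Fin n → F) (hli : LinearIndependent F h)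
    (hh : ∀ v, ∀ c ∈ C, h v ⬝ᵥ c = 0) {U : Finset (Fin n)} (hU : ∀ v i, h v i ≠ 0 → i ∈ U)
    {a : ℕ} (hUa : U.card ≤ a) (han : a ≤ n) (had : n < a + d) : k + m ≤ a := by
  obtain ⟨A, hUA, hA⟩ := Finset.exists_superset_card_eq hUa (by simpa using han)
  have := finrank_add_le_card_of_checks C h hli hh A (fun v i hi => hUA (hU v i hi))
    (fun c hc h0 => eq_zero_of_hasMinDist hd (by omega) hc h0)
  rwa [hC.1, hA] at this

open Classical in
/-- The Singleton-like bound `d ≤ n - k - ⌈k / r⌉ + 2` for locally recoverable codes: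
`⌈k / r⌉ - 1` local checks live on at most `k + ⌈k / r⌉ - 2` coordinates. -/
theorem IsLRC.singleton_bound {k r d : ℕ} (hk : 1 ≤ k) (hr : 1 ≤ r)
    {C : Submodule F (Fin n → F)} (hC : IsLRC k r C) (hd : HasMinDist C d) :
    d + k + kOne k r ≤ n + 2 := by
  by_contra! hcon
  have h1 := hC.dim_add_nOne_le
  have h2 := hC.kOne_le_nOne hr
  have h3 := le_kOne_mul (k := k) hr
  have h4 := kOne_mul_lt (k := k) hr
  have hpos : 1 ≤ kOne k r := by
    rcases Nat.eq_zero_or_pos (kOne k r) with h | h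
    · rw [h, mul_zero] at h3; omega
    · exact h
  obtain ⟨m, hm⟩ : ∃ m, kOne k r = m + 1 := ⟨kOne k r - 1, by omega⟩
  obtain ⟨h, hli, hh, hw⟩ := hC.exists_local_checks
  rw [hm] at h2 h3 h4 hcon
  -- `m` checks have total weight at most `m (r + 1) = (k₁ - 1) r + m ≤ k - 1 + m`
  have hmn : m ≤ nOne n r := by omega
  let h' : Fin m → Fin n → F := fun v => h (Fin.castLE hmn v)
  have hU : (Finset.univ.biUnion fun v => Finset.univ.filter fun i => h' v i ≠ 0).card
      ≤ k + m - 1 := by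
    refine (Finset.card_biUnion_le_card_mul _ _ (r + 1) fun v _ => hw _).trans ?_
    rw [Finset.card_univ, Fintype.card_fin, mul_add, mul_one]
    rw [add_mul, one_mul] at h4
    omega
  have := hC.dim_add_le_of_subset hd h' (hli.comp _ (Fin.castLE_injective hmn)) (fun v => hh _)
    (fun v i hi => by simpa using ⟨v, hi⟩) hU (by omega) (by omega)
  omega

end Dual

/-! ### The multigraph of a family of sets -/

section SetFamily

/-- The star multigraph of a family of sets `R v` with chosen owners `f i` of the points `i`: each
membership `i ∈ R v` with `v ≠ f i` which is listed in `E` is an edge between `v` and `f i`. Thus a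
point that lies in `m` of the sets contributes a star with at most `m - 1` edges. -/
def starGraph {V ι : Type*} (f : ι → V) (E : Set (V × ι)) : Graph V (V × ι) where
  vertexSet := Set.univ
  IsLink e x y := e ∈ E ∧ (x = e.1 ∧ y = f e.2 ∨ x = f e.2 ∧ y = e.1)
  edgeSet := E
  isLink_symm e _ := ⟨fun x y h => ⟨h.1, h.2.symm.imp And.symm And.symm⟩⟩
  eq_or_eq_of_isLink_of_isLink := by
    rintro e x y v w ⟨-, h⟩ ⟨-, h'⟩
    grind
  edge_mem_iff_exists_isLink e :=
    ⟨fun h => ⟨_, _, h, .inl ⟨rfl, rfl⟩⟩, fun ⟨_, _, h⟩ => h.1⟩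
  left_mem_of_isLink _ _ _ _ := Set.mem_univ _

open Classical in
/-- `n₁` subsets of size `r + 1` of an `n`-set, any `k₁` of which have a union of size at least
`k + k₁`, yield a good multigraph: the number of edges of the star multigraph inside a set of
vertices is at most the excess of the total size of the sets over the size of their union. -/
lemma exists_good_of_sets {n k r : ℕ} (hr : 1 ≤ r) (R : Fin (nOne n r) → Finset (Fin n))
    (hR : ∀ v, (R v).card = r + 1)
    (hU : ∀ W : Finset (Fin (nOne n r)), W.card = kOne k r →
      k + kOne k r ≤ (W.biUnion R).card) :
    ∃ (α β : Type) (G : Graph α β), IsGoodMultigraph n k r G := by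
  have hf : ∀ i, ∃ v, (∃ w, i ∈ R w) → i ∈ R v := by
    intro i
    by_cases h : ∃ w, i ∈ R w
    · exact ⟨h.choose, fun _ => h.choose_spec⟩
    · have hn : 0 < nOne n r := by
        rcases Nat.eq_zero_or_pos (nOne n r) with h0 | h0
        · have := le_nOne_mul n r
          have := i.2
          simp_all
        · exact h0
      exact ⟨⟨0, hn⟩, fun h' => absurd h' h⟩
  choose f hf using hf
  -- all memberships `i ∈ R v` with `v` in a given set of vertices
  let P : Finset (Fin (nOne n r)) → Finset (Fin (nOne n r) × Fin n) := fun W =>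
    (W ×ˢ Finset.univ).filter fun e => e.2 ∈ R e.1
  have hP : ∀ W, (P W).card = W.card * (r + 1) := by
    intro W
    have : P W = (W.sigma R).map (Equiv.sigmaEquivProd _ _).toEmbedding := by
      ext ⟨v, i⟩
      simp [P]
    rw [this, Finset.card_map, Finset.card_sigma, Finset.sum_congr rfl fun v _ => hR v]
    simp
  let E₀ := (P Finset.univ).filter fun e => e.1 ≠ f e.2
  have hE₀ : nTwo n r ≤ E₀.card := by
    have h1 := Finset.card_filter_add_card_filter_not (s := P Finset.univ) (fun e => e.1 ≠ f e.2)
    have h2 : ((P Finset.univ).filter fun e => ¬ e.1 ≠ f e.2).card ≤ n := by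
      calc _ ≤ (Finset.univ : Finset (Fin n)).card := by
            refine Finset.card_le_card_of_injOn Prod.snd (fun _ _ => Finset.mem_univ _) ?_
            rintro ⟨v, i⟩ h ⟨w, j⟩ h' (rfl : i = j)
            simp only [Finset.coe_filter, Set.mem_ofPred_eq, not_not] at h h'
            rw [h.2, h'.2]
        _ = n := by simp
    rw [hP, Finset.card_univ, Fintype.card_fin] at h1
    rw [nTwo]
    change E₀.card + _ = _ at h1
    omega
  obtain ⟨E, hEE₀, hE⟩ := Finset.exists_subset_card_eq hE₀
  refine ⟨_, _, starGraph f (E : Set (Fin (nOne n r) × Fin n)), ⟨?_⟩, ?_, ?_, ?_⟩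
  · rintro e x ⟨he, h⟩
    have := (Finset.mem_filter.1 (hEE₀ he)).2
    grind
  · simp [starGraph]
  · change (E : Set (Fin (nOne n r) × Fin n)).encard = _
    rw [Set.encard_coe_eq_coe_finsetCard, hE]
  · rintro ⟨H, hH, hHv, hHe⟩
    let W : Finset (Fin (nOne n r)) := H.vertexSet.toFinset
    have hW : W.card = kOne k r := by
      rw [← Set.coe_toFinset H.vertexSet, Set.encard_coe_eq_coe_finsetCard] at hHv
      exact_mod_cast hHv
    let D : Finset (Fin (nOne n r) × Fin n) := H.edgeSet.toFinset
    have hD : kTwo k r < D.card := by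
      rw [← Set.coe_toFinset H.edgeSet, Set.encard_coe_eq_coe_finsetCard] at hHe
      exact_mod_cast hHe
    have hDP : D ⊆ P W := by
      intro e he
      obtain ⟨x, y, hxy⟩ := H.exists_isLink_of_mem_edgeSet (Set.mem_toFinset.1 he)
      have hl := hH.2 hxy
      have h1 := (Finset.mem_filter.1 (hEE₀ hl.1)).1
      have h2 := (Finset.mem_filter.1 h1).2
      have hx := hxy.left_mem
      have hy := hxy.right_mem
      simp only [P, Finset.mem_filter, Finset.mem_product, Finset.mem_univ, and_true, W,
        Set.mem_toFinset]
      refine ⟨?_, h2⟩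
      rcases hl.2 with h | h
      · exact h.1 ▸ hx
      · exact h.2 ▸ hy
    -- each point of the union has a membership inside `W` that is not an edge of `H`
    have hcard : (W.biUnion R).card ≤ (P W \ D).card := by
      refine Finset.card_le_card_of_surjOn Prod.snd ?_
      intro i hi
      obtain ⟨w, hw, hiw⟩ := Finset.mem_biUnion.1 hi
      have hfi : i ∈ R (f i) := hf i ⟨w, hiw⟩
      have hne : ∀ v, (v, i) ∈ D → f i ∈ W := by
        intro v hv
        obtain ⟨x, y, hxy⟩ := H.exists_isLink_of_mem_edgeSet (Set.mem_toFinset.1 hv)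
        have hl := hH.2 hxy
        rcases hl.2 with h | h
        · exact h.2 ▸ Set.mem_toFinset.2 hxy.right_mem
        · exact h.1 ▸ Set.mem_toFinset.2 hxy.left_mem
      have hfD : (f i, i) ∉ D := by
        intro hv
        obtain ⟨x, y, hxy⟩ := H.exists_isLink_of_mem_edgeSet (Set.mem_toFinset.1 hv)
        exact (Finset.mem_filter.1 (hEE₀ (hH.2 hxy).1)).2 rfl
      by_cases hfW : f i ∈ W
      · exact ⟨(f i, i), by simp [P, hfW, hfi, hfD], rfl⟩
      · exact ⟨(w, i), by simpa [P, hw, hiw] using fun h => hfW (hne w h), rfl⟩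
    have hDle := Finset.card_le_card hDP
    rw [Finset.card_sdiff_of_subset hDP, hP, hW] at hcard
    rw [hP, hW, mul_add, mul_one] at hDle
    have := hU W hW
    have h3 := le_kOne_mul (k := k) hr
    rw [kTwo] at hD
    rw [mul_add, mul_one] at hcard
    rw [mul_comm] at h3
    omega

end SetFamily

open Classical in
/-- An optimal locally recoverable code yields a good multigraph: the supports of its `n₁`
independent local checks, enlarged to size `r + 1`, overlap so little that any `k₁` of them cover
at least `k + k₁` coordinates. -/
theorem IsOptimalLRC.exists_good {F : Type*} [Field F] {n k r : ℕ} (hr : 1 ≤ r) (hrk : r ≤ k)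
    (hkn : k < n) {C : Submodule F (Fin n → F)} (hC : IsOptimalLRC k r C) :
    ∃ (α β : Type) (G : Graph α β), IsGoodMultigraph n k r G := by
  obtain ⟨hC, d, hd, hdd⟩ := hC
  obtain ⟨h, hli, hh, hw⟩ := hC.exists_local_checks
  have hR : ∀ v, ∃ R : Finset (Fin n), (Finset.univ.filter fun i => h v i ≠ 0) ⊆ R ∧
      R.card = r + 1 := fun v => Finset.exists_superset_card_eq (hw v) (by simp; omega)
  choose R hhR hR using hR
  refine exists_good_of_sets hr R hR fun W hW => ?_
  by_contra! hcon
  have hpos := hd.pos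
  rw [dStar] at hdd
  let e := (W.orderEmbOfFin hW)
  have := hC.dim_add_le_of_subset hd (fun v => h (e v)) (hli.comp _ e.injective) (fun v => hh _)
    (U := W.biUnion R)
    (fun v i hi => Finset.mem_biUnion.2
      ⟨e v, Finset.orderEmbOfFin_mem _ _ _, hhR _ (by simpa using hi)⟩)
    (a := k + kOne k r - 1) (by omega) (by omega) (by omega)
  omega

/-! ### Good multigraphs -/

section Multigraph

variable {n k r : ℕ} {α β : Type*} {G : Graph α β}

/-- If `k₁ = n₁`, the whole multigraph is one of the subgraphs with `k₁` vertices. -/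
lemma IsGoodMultigraph.nTwo_le_kTwo (hG : IsGoodMultigraph n k r G)
    (h : kOne k r = nOne n r) : nTwo n r ≤ kTwo k r := by
  by_contra! hcon
  refine hG.2.2.2 ⟨G, le_rfl, by rw [hG.2.1, h], ?_⟩
  rw [hG.2.2.1]
  exact_mod_cast hcon

lemma IsGoodMultigraph.exists_ends (hG : IsGoodMultigraph n k r G) (e : G.edgeSet) :
    ∃ x y : G.vertexSet, x ≠ y ∧ ∀ v : G.vertexSet, G.Inc e.1 v.1 ↔ v = x ∨ v = y := by
  obtain ⟨x, y, hxy⟩ := G.exists_isLink_of_mem_edgeSet e.2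
  have := hG.1
  refine ⟨⟨x, hxy.left_mem⟩, ⟨y, hxy.right_mem⟩, fun h => hxy.ne (congrArg Subtype.val h),
    fun v => ?_⟩
  rw [Subtype.ext_iff, Subtype.ext_iff]
  constructor
  · exact fun h => h.eq_or_eq_of_isLink hxy
  · rintro (h | h)
    · exact h ▸ hxy.inc_left
    · exact h ▸ hxy.inc_right

lemma IsGoodMultigraph.finite_vertexSet (hG : IsGoodMultigraph n k r G) : Finite G.vertexSet :=
  (Set.finite_of_encard_eq_coe hG.2.1).to_subtype

lemma IsGoodMultigraph.finite_edgeSet (hG : IsGoodMultigraph n k r G) : Finite G.edgeSet :=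
  (Set.finite_of_encard_eq_coe hG.2.2.1).to_subtype

lemma IsGoodMultigraph.card_vertexSet (hG : IsGoodMultigraph n k r G) :
    Nat.card G.vertexSet = nOne n r := by
  rw [Nat.card_coe_set_eq, Set.ncard, hG.2.1, ENat.toNat_natCast]

lemma IsGoodMultigraph.card_edgeSet (hG : IsGoodMultigraph n k r G) :
    Nat.card G.edgeSet = nTwo n r := by
  rw [Nat.card_coe_set_eq, Set.ncard, hG.2.2.1, ENat.toNat_natCast]

/-! ### Full Tanner graphs -/

open Classical in
/-- The degrees in `G` sum to `2 n₂`, so that giving each vertex `v` private variable nodes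
up to degree `r + 1` uses `n₁ (r + 1) - 2 n₂ = n - n₂` of them. -/
lemma IsGoodMultigraph.exists_fullTannerGraph (hr : 1 ≤ r) (hk₁ : kOne k r ≤ nOne n r)
    (hG : IsGoodMultigraph n k r G) :
    ∃ T : Fin (n - k) → Fin n → Prop, IsFullTannerGraphOf r G T := by
  have := hG.finite_vertexSet
  have := hG.finite_edgeSet
  have := Fintype.ofFinite G.vertexSet
  have := Fintype.ofFinite G.edgeSet
  have hV : Fintype.card G.vertexSet = nOne n r := by
    rw [← Nat.card_eq_fintype_card, hG.card_vertexSet]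
  have hE : Fintype.card G.edgeSet = nTwo n r := by
    rw [← Nat.card_eq_fintype_card, hG.card_edgeSet]
  have hle := nOne_add_le hr hk₁ hG.nTwo_le_kTwo
  have hn2 := nTwo_le (n := n) (r := r)
  obtain ⟨check⟩ : Nonempty (G.vertexSet ↪ Fin (n - k)) :=
    Function.Embedding.nonempty_of_card_le (by rw [hV, Fintype.card_fin]; omega)
  let deg : G.vertexSet → ℕ := fun v =>
    (Finset.univ.filter fun e : G.edgeSet => G.Inc e.1 v.1).card
  have hdeg : ∀ v, deg v ≤ r := fun v => by
    refine (Finset.card_le_univ _).trans ?_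
    rw [hE]; exact hn2
  have hsum : ∑ v, deg v = nTwo n r * 2 := by
    have h1 := Finset.sum_card_bipartiteAbove_eq_sum_card_bipartiteBelow
      (s := (Finset.univ : Finset G.vertexSet)) (t := (Finset.univ : Finset G.edgeSet))
      (fun v e => G.Inc e.1 v.1)
    have h2 : ∀ e : G.edgeSet, (Finset.univ.bipartiteBelow
        (fun (v : G.vertexSet) (e : G.edgeSet) => G.Inc e.1 v.1) e).card = 2 := by
      intro e
      obtain ⟨x, y, hxy, h⟩ := hG.exists_ends e
      rw [← Finset.card_pair hxy]
      congr 1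
      ext v
      simp [Finset.bipartiteBelow, h]
    rw [Finset.sum_congr rfl fun e _ => h2 e] at h1
    rw [Finset.sum_const, Finset.card_univ, hE, smul_eq_mul] at h1
    exact h1
  have hcard : Fintype.card (Fin n) =
      Fintype.card (G.edgeSet ⊕ (Σ v : G.vertexSet, Fin (r + 1 - deg v))) := by
    have h1 : ∑ v, (r + 1 - deg v) + ∑ v, deg v = nOne n r * (r + 1) := by
      rw [← Finset.sum_add_distrib, Finset.sum_congr rfl fun v _ =>
        Nat.sub_add_cancel ((hdeg v).trans (Nat.le_succ r))]
      simp [hV]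
    have h2 := add_nTwo (n := n) (r := r)
    simp only [Fintype.card_fin, Fintype.card_sum, Fintype.card_sigma, hE]
    omega
  let φ := Fintype.equivOfCardEq hcard
  let P : G.vertexSet → G.edgeSet ⊕ (Σ v : G.vertexSet, Fin (r + 1 - deg v)) → Prop :=
    fun v => Sum.elim (fun e => G.Inc e.1 v.1) (fun s => s.1 = v)
  let T : Fin (n - k) → Fin n → Prop := fun j i =>
    (∃ v, check v = j ∧ P v (φ i)) ∨ j ∉ Set.range check
  have hT : ∀ v i, T (check v) i ↔ P v (φ i) := by
    intro v i
    constructor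
    · rintro (⟨w, hw, h⟩ | h)
      · exact check.injective hw ▸ h
      · exact absurd ⟨v, rfl⟩ h
    · exact fun h => .inl ⟨v, rfl, h⟩
  refine ⟨T, check, Function.Embedding.inl.trans φ.symm.toEmbedding, ?_, ?_, ?_, ?_⟩
  · intro v e
    rw [hT]
    change P v (φ (φ.symm (Sum.inl e))) ↔ _
    rw [Equiv.apply_symm_apply]
    rfl
  · intro i hi
    rcases hx : φ i with e | s
    · exact absurd ⟨e, φ.symm_apply_eq.2 hx.symm⟩ hi
    · refine ⟨s.1, (hT _ _).2 (by rw [hx]; rfl), fun v hv => ?_⟩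
      have h := (hT _ _).1 hv
      rw [hx] at h
      exact h.symm
  · intro v
    have h1 : {i | T (check v) i} = φ.symm '' {x | P v x} := by
      ext i
      rw [Equiv.image_eq_preimage_symm]
      exact hT v i
    have h2 : {x | P v x} = Sum.inl '' {e | G.Inc e.1 v.1} ∪
        Sum.inr '' (Sigma.mk v '' (Set.univ : Set (Fin (r + 1 - deg v)))) := by
      ext (e | ⟨w, a⟩)
      · simp [P]
      · simp only [P, Set.mem_ofPred_eq, Sum.elim_inr, Set.mem_union, Set.mem_image, reduceCtorEq,
          and_false, exists_false, false_or, Set.mem_univ, true_and, exists_exists_eq_and,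
          Sum.inr.injEq]
        constructor
        · rintro rfl; exact ⟨a, rfl⟩
        · rintro ⟨b, hb⟩; exact (congrArg Sigma.fst hb).symm
    have h3 : {e : G.edgeSet | G.Inc e.1 v.1}.ncard = deg v := by
      rw [Set.ncard_eq_toFinset_card']
      simp [deg]
    rw [h1, Set.ncard_image_of_injective _ φ.symm.injective, h2, Set.ncard_union_eq,
      Set.ncard_image_of_injective _ Sum.inl_injective,
      Set.ncard_image_of_injective _ Sum.inr_injective,
      Set.ncard_image_of_injective _ sigma_mk_injective, Set.ncard_univ, h3, Nat.card_fin]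
    · have := hdeg v
      omega
    · rw [Set.disjoint_left]
      rintro _ ⟨e, -, rfl⟩ ⟨s, -, hs⟩
      cases hs
  · exact fun j hj i => .inr hj

open Classical in
/-- A set `W` of at least `k₁` vertices spans at most `|W| r - k` edges: for `|W| = k₁` this is
goodness, and for larger `W` the bound exceeds `n₂`. -/
lemma IsGoodMultigraph.card_spanned_add_le (hr : 1 ≤ r) (hG : IsGoodMultigraph n k r G)
    (W : Set α) (hW : W ⊆ G.vertexSet) (hkW : kOne k r ≤ W.ncard) :
    (G.induce W).edgeSet.ncard + k ≤ W.ncard * r := by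
  have h1 := add_kTwo (k := k) hr
  have hfin : W.Finite := (Set.finite_of_encard_eq_coe hG.2.1).subset hW
  have hsub : (G.induce W).edgeSet ⊆ G.edgeSet := (Graph.induce_le hW).edgeSet_mono
  have hfinE := Set.finite_of_encard_eq_coe hG.2.2.1
  rcases hkW.eq_or_lt with h | h
  · have h2 : ¬ (kTwo k r : ℕ∞) < (G.induce W).edgeSet.encard := fun hlt =>
      hG.2.2.2 ⟨G.induce W, Graph.induce_le hW, by
        change W.encard = _
        rw [← hfin.cast_ncard_eq, h], hlt⟩
    rw [not_lt, ← (hfinE.subset hsub).cast_ncard_eq, Nat.cast_le] at h2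
    rw [← h]
    omega
  · have h2 := Set.ncard_le_ncard hsub hfinE
    have h3 : G.edgeSet.ncard = nTwo n r := hG.card_edgeSet
    have h4 := nTwo_le (n := n) (r := r)
    have h5 : (kOne k r + 1) * r ≤ W.ncard * r := Nat.mul_le_mul_right r h
    rw [add_mul, one_mul] at h5
    omega

open Classical in
/-- Hall's condition: every set `S` of at most `d* - 1` variable nodes has at least `|S|`
neighbours. The check nodes missed by `S` are local and form a set `W`; the variable nodes
adjacent to `W` number at least `|W| (r + 1) - e(W) ≥ |W| + k` and are not in `S`, so if `S` had
fewer than `|S|` neighbours, it would not fit. -/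
lemma IsGoodMultigraph.card_le_card_neighbors (hr : 1 ≤ r) (hk₁ : kOne k r ≤ nOne n r)
    (hG : IsGoodMultigraph n k r G) {T : Fin (n - k) → Fin n → Prop}
    (hT : IsFullTannerGraphOf r G T) (S : Finset (Fin n))
    (hS : S.card + k + kOne k r ≤ n + 1) :
    S.card ≤ (Finset.univ.filter fun j => ∃ i ∈ S, T j i).card := by
  obtain ⟨check, var, hvar, hpriv, hdeg, hall⟩ := hT
  by_contra! hcon
  have := hG.finite_vertexSet
  have := hG.finite_edgeSet
  have := Fintype.ofFinite G.vertexSet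
  have := Fintype.ofFinite G.edgeSet
  have hle := nOne_add_le hr hk₁ hG.nTwo_le_kTwo
  obtain ⟨i₀, hi₀⟩ : S.Nonempty := Finset.card_pos.1 (by omega)
  let W : Finset G.vertexSet := Finset.univ.filter fun v => ∀ i ∈ S, ¬ T (check v) i
  have hcompl : (Finset.univ.filter fun j => ∃ i ∈ S, T j i)ᶜ ⊆ W.map check := by
    intro j hj
    simp only [Finset.mem_compl, Finset.mem_filter, Finset.mem_univ, true_and, not_exists,
      not_and] at hj
    by_cases hjr : j ∈ Set.range check
    · obtain ⟨v, rfl⟩ := hjr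
      exact Finset.mem_map_of_mem _ (by simpa [W] using hj)
    · exact absurd (hall j hjr i₀) (hj i₀ hi₀)
  have h1 := Finset.card_le_card hcompl
  rw [Finset.card_map, Finset.card_compl, Fintype.card_fin] at h1
  let N : Finset (Fin n) := Finset.univ.filter fun i => ∃ v ∈ W, T (check v) i
  have hSN : S.card + N.card ≤ n := by
    rw [← Finset.card_union_of_disjoint]
    · simpa using Finset.card_le_univ (S ∪ N)
    · rw [Finset.disjoint_left]
      intro i hi hi'
      obtain ⟨v, hv, h⟩ := (Finset.mem_filter.1 hi').2
      exact (Finset.mem_filter.1 hv).2 i hi h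
  let EW : Finset G.edgeSet := Finset.univ.filter fun e => ∀ v, G.Inc e.1 v.1 → v ∈ W
  have hEW : EW.card + k ≤ W.card * r := by
    let W' : Set α := Subtype.val '' (W : Set G.vertexSet)
    have hW' : W'.ncard = W.card := by
      rw [Set.ncard_image_of_injective _ Subtype.val_injective, Set.ncard_coe_finset]
    have h2 := hG.card_spanned_add_le hr W' (by rintro _ ⟨v, -, rfl⟩; exact v.2)
      (by rw [hW']; omega)
    rw [hW'] at h2
    refine le_trans (Nat.add_le_add_right ?_ k) h2
    rw [← Finset.card_map (Function.Embedding.subtype _), ← Set.ncard_coe_finset]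
    refine Set.ncard_le_ncard ?_ ((Set.finite_of_encard_eq_coe hG.2.2.1).subset ?_)
    · intro e he
      rw [Finset.mem_coe, Finset.mem_map] at he
      obtain ⟨e, he, rfl⟩ := he
      obtain ⟨x, y, hxy⟩ := G.exists_isLink_of_mem_edgeSet e.2
      have he' := (Finset.mem_filter.1 he).2
      exact ⟨x, y, hxy, ⟨⟨x, hxy.left_mem⟩, he' _ hxy.inc_left, rfl⟩,
        ⟨⟨y, hxy.right_mem⟩, he' _ hxy.inc_right, rfl⟩⟩
    · rintro e ⟨x, y, hxy, -, -⟩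
      exact hxy.edge_mem
  -- double counting of the edges of `T` at `W`
  have hcount : W.card * (r + 1) ≤ N.card + EW.card := by
    have h2 := Finset.sum_card_bipartiteAbove_eq_sum_card_bipartiteBelow
      (s := W) (t := (Finset.univ : Finset (Fin n))) (fun v i => T (check v) i)
    have h3 : ∀ v ∈ W, (Finset.univ.bipartiteAbove
        (fun (v : G.vertexSet) (i : Fin n) => T (check v) i) v).card = r + 1 := by
      intro v _
      rw [← hdeg v, Set.ncard_eq_toFinset_card']
      simp [Finset.bipartiteAbove]
    rw [Finset.sum_congr rfl h3, Finset.sum_const, smul_eq_mul] at h2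
    rw [h2, ← Finset.card_map var (s := EW)]
    have h4 : ∀ i, (W.bipartiteBelow
        (fun (v : G.vertexSet) (i : Fin n) => T (check v) i) i).card ≤
        (if i ∈ N then 1 else 0) + if i ∈ EW.map var then 1 else 0 := by
      intro i
      by_cases hiN : i ∈ N
      · rw [if_pos hiN]
        by_cases hi : i ∈ Set.range var
        · obtain ⟨e, rfl⟩ := hi
          obtain ⟨x, y, hxy, h⟩ := hG.exists_ends e
          have hsub : (W.bipartiteBelow (fun (v : G.vertexSet) (i : Fin n) => T (check v) i)
              (var e)) = W ∩ {x, y} := by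
            ext v
            simp [Finset.bipartiteBelow, hvar, h]
          rw [hsub]
          by_cases he : var e ∈ EW.map var
          · rw [if_pos he]
            exact (Finset.card_le_card Finset.inter_subset_right).trans Finset.card_le_two
          · rw [if_neg he, Finset.card_le_one]
            intro a ha b hb
            by_contra hab
            simp only [Finset.mem_inter, Finset.mem_insert, Finset.mem_singleton] at ha hb
            refine he (Finset.mem_map_of_mem _ (Finset.mem_filter.2 ⟨Finset.mem_univ _, ?_⟩))
            intro v hv
            rw [h] at hv
            grind
        · refine le_trans (Finset.card_le_one.2 ?_) (Nat.le_add_right _ _)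
          obtain ⟨v, -, hv⟩ := hpriv i hi
          intro a ha b hb
          rw [hv a (Finset.mem_filter.1 ha).2, hv b (Finset.mem_filter.1 hb).2]
      · refine le_trans (Finset.card_le_card (t := ∅) fun v hv => ?_) (Nat.zero_le _)
        exact absurd (Finset.mem_filter.2 ⟨Finset.mem_univ _, v, (Finset.mem_filter.1 hv).1,
          (Finset.mem_filter.1 hv).2⟩) hiN
    refine (Finset.sum_le_sum fun i _ => h4 i).trans ?_
    rw [Finset.sum_add_distrib, Finset.sum_boole, Finset.sum_boole]
    simp only [Finset.filter_univ_mem, Nat.cast_id, le_refl]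
  rw [mul_add, mul_one] at hcount
  omega

/-- Any `d* - 1` variable nodes can be matched into distinct check nodes. -/
lemma IsGoodMultigraph.exists_matching (hr : 1 ≤ r) (hk₁ : kOne k r ≤ nOne n r)
    (hG : IsGoodMultigraph n k r G) {T : Fin (n - k) → Fin n → Prop}
    (hT : IsFullTannerGraphOf r G T) {t : ℕ} (ht : t + k + kOne k r ≤ n + 1)
    (c : Fin t ↪ Fin n) : ∃ σ : Fin t → Fin (n - k), Function.Injective σ ∧
      ∀ a, T (σ a) (c a) := by
  classical
  have := (Finset.all_card_le_biUnion_card_iff_exists_injective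
    (fun a => Finset.univ.filter fun j => T j (c a))).1 fun s => by
      have h1 := hG.card_le_card_neighbors hr hk₁ hT (s.map c) (by
        have := Finset.card_le_univ s
        rw [Fintype.card_fin] at this
        rw [Finset.card_map]; omega)
      rw [Finset.card_map] at h1
      refine h1.trans (Finset.card_le_card fun j hj => ?_)
      simpa using hj
  simpa using this

end Multigraph

/-! ### Counting singular minors -/

section Counting

variable {F : Type*} [Field F] [Finite F] {m n : ℕ}

/-- If a minor of a random matrix on `T` contains a matching of `T`, it vanishes with probability
at most `(t - 1) / (q - 1)`. By induction on `t`: when the complementary minor of a matched entry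
is nonzero, at most one value of that entry makes the determinant vanish, so that overwriting the
entry by an arbitrary nonzero value is an injective operation. A single matched entry never
vanishes, whence `t - 1` in place of `t`. -/
lemma ncard_det_eq_zero_mul_le (T : Fin m → Fin n → Prop) {t : ℕ} (σ : Fin t → Fin m)
    (c : Fin t → Fin n) (hσ : Function.Injective σ) (hc : Function.Injective c)
    (hT : ∀ a, T (σ a) (c a)) :
    {H ∈ matricesOn F T | (H.submatrix σ c).det = 0}.ncard * (Nat.card F - 1) ≤
      (t - 1) * (matricesOn F T).ncard := by
  classical
  induction t with
  | zero => simp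
  | succ t ih =>
    rcases Nat.eq_zero_or_pos t with rfl | ht
    · have : {H ∈ matricesOn F T | (H.submatrix σ c).det = 0} = ∅ := by
        rw [Set.eq_empty_iff_forall_notMem]
        rintro H ⟨hH, h⟩
        rw [Matrix.det_fin_one] at h
        exact (hH _ _).2 (hT 0) h
      rw [this, Set.ncard_empty, zero_mul]
      exact Nat.zero_le _
    have ih' := ih (fun a => σ a.succ) (fun a => c a.succ)
      (hσ.comp (Fin.succ_injective _)) (hc.comp (Fin.succ_injective _)) fun a => hT a.succ
    let B := {H ∈ matricesOn F T |
      (H.submatrix (fun a : Fin t => σ a.succ) (fun a : Fin t => c a.succ)).det ≠ 0 ∧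
      (H.submatrix σ c).det = 0}
    have hB : B.ncard * (Nat.card F - 1) ≤ (matricesOn F T).ncard := by
      have h1 : ({a : F | a ≠ 0}).ncard = Nat.card F - 1 := by
        change ({0}ᶜ : Set F).ncard = _
        rw [Set.ncard_compl, Set.ncard_singleton]
      rw [← h1, ← Set.ncard_prod]
      let U : Matrix (Fin m) (Fin n) F × F → Matrix (Fin m) (Fin n) F := fun p j i =>
        if j = σ 0 ∧ i = c 0 then p.2 else p.1 j i
      refine Set.ncard_le_ncard_of_injOn U ?_ ?_ (Set.toFinite _)
      · rintro ⟨H, a⟩ ⟨hH, ha⟩ j i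
        by_cases h : j = σ 0 ∧ i = c 0
        · simp only [U, if_pos h]
          rw [h.1, h.2]
          exact ⟨fun _ => hT 0, fun _ => ha⟩
        · simp only [U, if_neg h]
          exact hH.1 j i
      · rintro ⟨H, a⟩ ⟨⟨-, hH1, hH2⟩, ha⟩ ⟨H', a'⟩ ⟨⟨-, hH1', hH2'⟩, ha'⟩ heq
        have haa : a = a' := by
          have := congrFun (congrFun heq (σ 0)) (c 0)
          simpa [U] using this
        have hoff : ∀ j i, ¬ (j = σ 0 ∧ i = c 0) → H j i = H' j i := by
          intro j i h
          have := congrFun (congrFun heq j) i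
          simpa only [U, if_neg h] using this
        have hrow : ∀ (a : Fin t) i, H (σ a.succ) i = H' (σ a.succ) i := fun a i =>
          hoff _ _ fun h => Fin.succ_ne_zero a (hσ h.1)
        have hminor : ∀ f : Fin t → Fin n, H.submatrix (fun a : Fin t => σ a.succ) f =
            H'.submatrix (fun a : Fin t => σ a.succ) f := fun f => by
          ext a b; exact hrow a _
        have hcorner : H (σ 0) (c 0) = H' (σ 0) (c 0) := by
          have hdet := hH2.trans hH2'.symm
          simp only at hdet
          rw [Matrix.det_succ_row_zero, Matrix.det_succ_row_zero, Fin.sum_univ_succ,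
            Fin.sum_univ_succ] at hdet
          have htail : ∀ b : Fin t, H (σ 0) (c b.succ) = H' (σ 0) (c b.succ) := fun b =>
            hoff _ _ fun h => Fin.succ_ne_zero b (hc h.2)
          simp only [Matrix.submatrix_apply, Matrix.submatrix_submatrix, Function.comp_def,
            hminor, htail, add_left_inj] at hdet
          simp only [Fin.val_zero, pow_zero, one_mul, Fin.succAbove_zero] at hdet
          exact mul_right_cancel₀ hH1' hdet
        refine Prod.ext ?_ haa
        ext j i
        by_cases h : j = σ 0 ∧ i = c 0
        · rw [h.1, h.2]; exact hcorner
        · exact hoff j i h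
    have hsub : {H ∈ matricesOn F T | (H.submatrix σ c).det = 0} ⊆
        {H ∈ matricesOn F T |
          (H.submatrix (fun a : Fin t => σ a.succ) (fun a : Fin t => c a.succ)).det = 0} ∪ B := by
      rintro H ⟨hH, h⟩
      by_cases h' : (H.submatrix (fun a : Fin t => σ a.succ) (fun a : Fin t => c a.succ)).det = 0
      · exact .inl ⟨hH, h'⟩
      · exact .inr ⟨hH, h', h⟩
    have h2 := (Set.ncard_le_ncard hsub (Set.toFinite _)).trans (Set.ncard_union_le _ _)
    obtain ⟨s, rfl⟩ : ∃ s, t = s + 1 := ⟨t - 1, by omega⟩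
    calc _ ≤ _ := Nat.mul_le_mul_right _ h2
      _ ≤ (s + 1 - 1) * (matricesOn F T).ncard + (matricesOn F T).ncard := by
        rw [add_mul]; exact add_le_add ih' hB
      _ = _ := by simp only [Nat.add_sub_cancel]; ring

lemma choose_mul_pred_mul_le {n t : ℕ} (ht : 1 ≤ t) :
    n.choose t * (t - 1) * n ≤ n ^ t * (n - 1) := by
  rcases ht.eq_or_lt with rfl | ht
  · simp
  obtain ⟨s, rfl⟩ : ∃ s, t = s + 2 := ⟨t - 2, by omega⟩
  rcases n with _ | n
  · simp
  have h1 := Nat.add_one_mul_choose_eq n (s + 1)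
  have h2 : n.choose (s + 1) ≤ n ^ (s + 1) := Nat.choose_le_pow _ _
  have h3 : n ^ s ≤ (n + 1) ^ s := Nat.pow_le_pow_left (Nat.le_succ n) s
  calc (n + 1).choose (s + 2) * (s + 2 - 1) * (n + 1)
      ≤ (n + 1).choose (s + 2) * (s + 2) * (n + 1) := by gcongr; omega
    _ = (n + 1) * n.choose (s + 1) * (n + 1) := by rw [h1]
    _ ≤ (n + 1) * ((n + 1) ^ s * n) * (n + 1) := by
      gcongr
      calc _ ≤ n ^ s * n := by rw [← pow_succ]; exact h2
        _ ≤ _ := by gcongr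
    _ = (n + 1) ^ (s + 2) * (n + 1 - 1) := by rw [Nat.add_sub_cancel]; ring

end Counting

/-! ### Random parity-check matrices -/

section ParityCheck

variable {n k r : ℕ} {α β : Type*} {G : Graph α β} {F : Type*} [Field F]

open Classical in
/-- Every coordinate of the code of a matrix on a full Tanner graph is recovered from the `r`
others of a local check node. -/
lemma IsFullTannerGraphOf.exists_recovery_set (hG : IsGoodMultigraph n k r G)
    {T : Fin (n - k) → Fin n → Prop} (hT : IsFullTannerGraphOf r G T)
    {H : Matrix (Fin (n - k)) (Fin n) F} (hH : H ∈ matricesOn F T) (i : Fin n) :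
    ∃ S : Finset (Fin n), i ∉ S ∧ S.card ≤ r ∧
      ∃ a : Fin n → F, ∀ c ∈ codeOf H, c i = ∑ j ∈ S, a j * c j := by
  obtain ⟨check, var, hvar, hpriv, hdeg, -⟩ := hT
  obtain ⟨v, hv⟩ : ∃ v, T (check v) i := by
    by_cases hi : i ∈ Set.range var
    · obtain ⟨e, rfl⟩ := hi
      obtain ⟨x, y, -, h⟩ := hG.exists_ends e
      exact ⟨x, (hvar _ _).2 ((h x).2 (.inl rfl))⟩
    · exact (hpriv i hi).exists
  let N : Finset (Fin n) := Finset.univ.filter fun j => T (check v) j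
  have hN : N.card = r + 1 := by
    rw [← hdeg v, Set.ncard_eq_toFinset_card']
    simp [N]
  have hiN : i ∈ N := by simpa [N] using hv
  have hne : H (check v) i ≠ 0 := (hH _ _).2 hv
  refine ⟨N.erase i, Finset.notMem_erase _ _, by rw [Finset.card_erase_of_mem hiN, hN]; simp,
    fun j => -(H (check v) j / H (check v) i), fun c hc => ?_⟩
  have h1 : ∑ j, H (check v) j * c j = 0 := congrFun (LinearMap.mem_ker.1 hc) (check v)
  have h2 : ∑ j ∈ N, H (check v) j * c j = 0 := by
    rw [← h1]
    refine Finset.sum_subset (Finset.subset_univ _) fun j _ hj => ?_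
    have : H (check v) j = 0 := by
      by_contra h
      exact hj (Finset.mem_filter.2 ⟨Finset.mem_univ _, (hH _ _).1 h⟩)
    rw [this, zero_mul]
  rw [← Finset.add_sum_erase _ _ hiN] at h2
  have h3 : ∑ j ∈ N.erase i, -(H (check v) j / H (check v) i) * c j =
      -(∑ j ∈ N.erase i, H (check v) j * c j) / H (check v) i := by
    rw [neg_div, Finset.sum_div, ← Finset.sum_neg_distrib]
    exact Finset.sum_congr rfl fun j _ => by ring
  rw [h3, eq_div_iff hne]
  linear_combination h2

lemma le_finrank_codeOf (hkn : k < n) (H : Matrix (Fin (n - k)) (Fin n) F) :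
    k ≤ Module.finrank F (codeOf H) := by
  have h1 := LinearMap.finrank_range_add_finrank_ker H.mulVecLin
  have h2 := Submodule.finrank_le (LinearMap.range H.mulVecLin)
  simp only [Module.finrank_fintype_fun_eq_card, Fintype.card_fin] at h1 h2
  rw [codeOf]
  omega

open Classical in
lemma exists_hasMinDist {C : Submodule F (Fin n → F)} (hC : C ≠ ⊥) : ∃ d, HasMinDist C d := by
  obtain ⟨x, hx, hne⟩ := C.ne_bot_iff.1 hC
  have : {w : ℕ | ∃ x ∈ C, ∃ y ∈ C, x ≠ y ∧ hammingDist x y = w}.Nonempty :=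
    ⟨_, x, hx, 0, C.zero_mem, hne, rfl⟩
  exact ⟨_, Nat.sInf_mem this, fun _ h => Nat.sInf_le h⟩

open Classical in
/-- If every `t` columns contain a nonsingular `t × t` submatrix, nonzero codewords have weight
more than `t`. -/
lemma lt_hammingNorm_of_det_ne_zero {m t : ℕ} (htn : t ≤ n) {H : Matrix (Fin m) (Fin n) F}
    (hdet : ∀ S : {S : Finset (Fin n) // S.card = t}, ∃ σ : Fin t → Fin m,
      (H.submatrix σ (S.1.orderEmbOfFin S.2)).det ≠ 0)
    {x : Fin n → F} (hx : x ∈ codeOf H) (hne : x ≠ 0) : t < hammingNorm x := by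
  by_contra! hcon
  obtain ⟨S, hsub, hS⟩ := Finset.exists_superset_card_eq
    (s := Finset.univ.filter fun i => x i ≠ 0) hcon (by simpa using htn)
  have hout : ∀ i ∉ S, x i = 0 := fun i hi => by
    by_contra h
    exact hi (hsub (by simpa using h))
  obtain ⟨σ, hσ⟩ := hdet ⟨S, hS⟩
  have h0 := Matrix.eq_zero_of_mulVec_eq_zero hσ (v := fun b => x (S.orderEmbOfFin hS b)) (by
    ext a
    have h1 : ∑ i, H (σ a) i * x i = 0 := congrFun (LinearMap.mem_ker.1 hx) (σ a)
    have h2 : ∑ i ∈ S, H (σ a) i * x i = ∑ i, H (σ a) i * x i :=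
      Finset.sum_subset (Finset.subset_univ S) fun i _ hi => by rw [hout i hi, mul_zero]
    rw [Pi.zero_apply, ← h1, ← h2, ← Finset.sum_coe_sort]
    change ∑ b, H (σ a) (S.orderEmbOfFin hS b) * x (S.orderEmbOfFin hS b) = _
    exact Fintype.sum_equiv (S.orderIsoOfFin hS).toEquiv _ _ fun b => rfl)
  refine hne (funext fun i => ?_)
  by_cases hi : i ∈ S
  · have := congrFun h0 ((S.orderIsoOfFin hS).symm ⟨i, hi⟩)
    simpa [← Finset.coe_orderIsoOfFin_apply] using this
  · exact hout i hi

open Classical in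
/-- A matrix on a full Tanner graph all of whose `d* - 1` columns are independent defines an
optimal code: its dimension is at least `k` and its distance at least `d*`, and the Singleton-like
bound leaves no room for more of either. -/
lemma IsFullTannerGraphOf.isOptimalLRC (hr : 1 ≤ r) (hk : 1 ≤ k) (hkn : k < n)
    (hG : IsGoodMultigraph n k r G) {T : Fin (n - k) → Fin n → Prop}
    (hT : IsFullTannerGraphOf r G T) {t : ℕ} (ht : t + k + kOne k r = n + 1) (htn : t ≤ n)
    {H : Matrix (Fin (n - k)) (Fin n) F} (hH : H ∈ matricesOn F T)
    (hdet : ∀ S : {S : Finset (Fin n) // S.card = t}, ∃ σ : Fin t → Fin (n - k),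
      (H.submatrix σ (S.1.orderEmbOfFin S.2)).det ≠ 0) :
    IsOptimalLRC k r (codeOf H) := by
  have hK := le_finrank_codeOf hkn H
  have hlrc : IsLRC (Module.finrank F (codeOf H)) r (codeOf H) :=
    ⟨rfl, hT.exists_recovery_set hG hH⟩
  obtain ⟨d, hd⟩ := exists_hasMinDist (C := codeOf H) (by
    intro h
    rw [h, finrank_bot] at hK
    omega)
  have hdt : t < d := by
    obtain ⟨x, hx, y, hy, hxy, h⟩ := hd.1
    rw [← h, hammingDist_eq_hammingNorm]
    exact lt_hammingNorm_of_det_ne_zero htn hdet ((codeOf H).add_mem ((codeOf H).neg_mem hx) hy)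
      (fun h => hxy (neg_add_eq_zero.1 h))
  have h1 := hlrc.singleton_bound (hk.trans hK) hr hd
  have h2 := kOne_mono hr hK
  have hKk : Module.finrank F (codeOf H) = k := by omega
  rw [hKk] at hlrc h1
  exact ⟨hlrc, d, hd, by rw [dStar]; omega⟩

lemma matricesOn_nonempty {m : ℕ} (T : Fin m → Fin n → Prop) : (matricesOn F T).Nonempty := by
  classical
  exact ⟨fun j i => if T j i then 1 else 0, fun j i => by simp⟩

open Classical in
/-- The union bound over the `(d* - 1)`-sets of columns. -/
lemma IsFullTannerGraphOf.ncard_not_optimal_mul_le [Finite F] (hr : 1 ≤ r) (hk : 1 ≤ k)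
    (hkn : k < n) (hk₁ : kOne k r ≤ nOne n r)
    (hG : IsGoodMultigraph n k r G) {T : Fin (n - k) → Fin n → Prop}
    (hT : IsFullTannerGraphOf r G T) {t : ℕ} (ht : t + k + kOne k r = n + 1) (htn : t ≤ n) :
    {H ∈ matricesOn F T | ¬ IsOptimalLRC k r (codeOf H)}.ncard * (Nat.card F - 1) ≤
      n.choose t * (t - 1) * (matricesOn F T).ncard := by
  have hmatch := fun S : {S : Finset (Fin n) // S.card = t} =>
    hG.exists_matching hr hk₁ hT ht.le (S.1.orderEmbOfFin S.2).toEmbedding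
  choose σ hσ hσT using hmatch
  let B : {S : Finset (Fin n) // S.card = t} → Set (Matrix (Fin (n - k)) (Fin n) F) := fun S =>
    {H ∈ matricesOn F T | (H.submatrix (σ S) (S.1.orderEmbOfFin S.2)).det = 0}
  have hsub : {H ∈ matricesOn F T | ¬ IsOptimalLRC k r (codeOf H)} ⊆
      ⋃ S ∈ (Finset.univ : Finset {S : Finset (Fin n) // S.card = t}), B S := by
    rintro H ⟨hH, hno⟩
    by_contra hcon
    simp only [Set.mem_iUnion, not_exists] at hcon
    exact hno (hT.isOptimalLRC hr hk hkn hG ht htn hH fun S =>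
      ⟨σ S, fun h => hcon S (Finset.mem_univ _) ⟨hH, h⟩⟩)
  have h1 := (Set.ncard_le_ncard hsub (Set.toFinite _)).trans
    (Finset.set_ncard_biUnion_le Finset.univ B)
  calc _ ≤ (∑ S, (B S).ncard) * (Nat.card F - 1) := Nat.mul_le_mul_right _ h1
    _ ≤ ∑ _S : {S : Finset (Fin n) // S.card = t}, (t - 1) * (matricesOn F T).ncard := by
      rw [Finset.sum_mul]
      exact Finset.sum_le_sum fun S _ => ncard_det_eq_zero_mul_le T (σ S) _ (hσ S)
        (S.1.orderEmbOfFin S.2).injective (hσT S)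
    _ = _ := by
      rw [Finset.sum_const, Finset.card_univ, Fintype.card_finset_len, Fintype.card_fin,
        smul_eq_mul, mul_assoc]

/-- The probability of an optimal code is at least `1 - n ^ (d* - 1) / q`. -/
lemma IsFullTannerGraphOf.le_probOptimal [Finite F] (hr : 1 ≤ r) (hk : 1 ≤ k)
    (hkn : k < n) (hk₁ : kOne k r ≤ nOne n r)
    (hG : IsGoodMultigraph n k r G) {T : Fin (n - k) → Fin n → Prop}
    (hT : IsFullTannerGraphOf r G T) {t : ℕ} (ht : t + k + kOne k r = n + 1) (ht1 : 1 ≤ t) :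
    1 - (n : ℝ) ^ t / (Nat.card F : ℝ) ≤ probOptimal k r F T := by
  have hq : (0 : ℝ) < Nat.card F := by exact_mod_cast Nat.card_pos
  -- for `q ≤ n ^ t` the bound is trivial; otherwise `n ≤ q`
  rcases le_or_gt (Nat.card F : ℝ) ((n : ℝ) ^ t) with hle | hlt
  · have : 0 ≤ probOptimal k r F T := by rw [probOptimal]; positivity
    have : 1 ≤ (n : ℝ) ^ t / (Nat.card F : ℝ) := (one_le_div hq).2 hle
    linarith
  have hn : (2 : ℝ) ≤ n := by exact_mod_cast (by omega : 2 ≤ n)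
  have hnq : (n : ℝ) ≤ Nat.card F := by
    refine le_trans ?_ hlt.le
    calc (n : ℝ) = (n : ℝ) ^ 1 := (pow_one _).symm
      _ ≤ _ := pow_le_pow_right₀ (by linarith) ht1
  have h1 := hT.ncard_not_optimal_mul_le (F := F) hr hk hkn hk₁ hG ht (by omega)
  have h2 := choose_mul_pred_mul_le (n := n) ht1
  have hM : 0 < (matricesOn F T).ncard := (Set.ncard_pos (Set.toFinite _)).2 (matricesOn_nonempty T)
  have h3 : {H ∈ matricesOn F T | IsOptimalLRC k r (codeOf H)}.ncard +
      {H ∈ matricesOn F T | ¬ IsOptimalLRC k r (codeOf H)}.ncard = (matricesOn F T).ncard := by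
    rw [← Set.ncard_union_eq _ (Set.toFinite _) (Set.toFinite _)]
    · congr 1
      ext H
      simp only [Set.mem_union, Set.mem_ofPred_eq]
      exact ⟨fun h => h.elim And.left And.left,
        fun h => (em (IsOptimalLRC k r (codeOf H))).imp (And.intro h) (And.intro h)⟩
    · rw [Set.disjoint_left]
      exact fun H h h' => h'.2 h.2
  rw [probOptimal]
  set M := (matricesOn F T).ncard
  set b := {H ∈ matricesOn F T | ¬ IsOptimalLRC k r (codeOf H)}.ncard
  set g := {H ∈ matricesOn F T | IsOptimalLRC k r (codeOf H)}.ncard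
  set q := Nat.card F
  have hM' : (0 : ℝ) < M := by exact_mod_cast hM
  have hq1 : ((q - 1 : ℕ) : ℝ) = q - 1 := by
    rw [Nat.cast_sub Nat.card_pos, Nat.cast_one]
  have hn1 : ((n - 1 : ℕ) : ℝ) = n - 1 := by
    rw [Nat.cast_sub (by omega), Nat.cast_one]
  have h1' : (b : ℝ) * (q - 1) ≤ ((n.choose t * (t - 1) : ℕ) : ℝ) * M := by
    rw [← hq1]; exact_mod_cast h1
  have h2' : ((n.choose t * (t - 1) : ℕ) : ℝ) * n ≤ (n : ℝ) ^ t * (n - 1) := by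
    rw [← hn1]; exact_mod_cast h2
  have h3' : (g : ℝ) + b = M := by exact_mod_cast h3
  have key : (b : ℝ) * q ≤ (n : ℝ) ^ t * M := by
    have hpos : (0 : ℝ) < (q - 1) * n := by nlinarith
    refine le_of_mul_le_mul_right ?_ hpos
    have hp : (0 : ℝ) ≤ (n : ℝ) ^ t := by positivity
    calc (b : ℝ) * q * ((q - 1) * n) = (b * (q - 1)) * (q * n) := by ring
      _ ≤ (((n.choose t * (t - 1) : ℕ) : ℝ) * M) * (q * n) := by gcongr
      _ = (((n.choose t * (t - 1) : ℕ) : ℝ) * n) * (M * q) := by ring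
      _ ≤ ((n : ℝ) ^ t * (n - 1)) * (M * q) := by gcongr
      _ = ((n : ℝ) ^ t * M) * (q * n - q) := by ring
      _ ≤ ((n : ℝ) ^ t * M) * (q * n - n) := by gcongr
      _ = ((n : ℝ) ^ t * M) * ((q - 1) * n) := by ring
  have h4 : (b : ℝ) / M ≤ (n : ℝ) ^ t / q := by
    rw [div_le_div_iff₀ hM' hq]
    exact key
  have h5 : (g : ℝ) / M = 1 - b / M := by
    rw [← h3', eq_sub_iff_add_eq, ← add_div, div_self (by rw [h3']; exact hM'.ne')]
  rw [h5]
  linarith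

/-- Bertrand's postulate supplies a prime field of order between `n ^ d*` and `2 n ^ d*`. -/
lemma IsFullTannerGraphOf.exists_field (hr : 1 ≤ r) (hk : 1 ≤ k)
    (hkn : k < n) (hk₁ : kOne k r ≤ nOne n r)
    (hG : IsGoodMultigraph n k r G) {T : Fin (n - k) → Fin n → Prop}
    (hT : IsFullTannerGraphOf r G T) {t : ℕ} (ht : t + k + kOne k r = n + 1) (ht1 : 1 ≤ t) :
    ∃ (F : Type) (_ : Field F) (_ : Finite F),
      (Nat.card F : ℝ) ≤ 2 * (n : ℝ) ^ (t + 1) ∧ 1 - 1 / (n : ℝ) ≤ probOptimal k r F T ∧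
      ∃ H ∈ matricesOn F T, IsOptimalLRC k r (codeOf H) := by
  obtain ⟨p, hp, hlt, hle⟩ := Nat.exists_prime_lt_and_le_two_mul (n ^ (t + 1))
    (pow_ne_zero _ (by omega))
  have : Fact p.Prime := ⟨hp⟩
  have hn : (2 : ℝ) ≤ n := by exact_mod_cast (by omega : 2 ≤ n)
  have hprob : 1 - 1 / (n : ℝ) ≤ probOptimal k r (ZMod p) T := by
    refine le_trans ?_ (hT.le_probOptimal hr hk hkn hk₁ hG ht ht1)
    rw [Nat.card_zmod]
    have hlt' : (n : ℝ) ^ (t + 1) < p := by exact_mod_cast hlt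
    have hp0 : (0 : ℝ) < p := by exact_mod_cast hp.pos
    have : (n : ℝ) ^ t / p ≤ 1 / n := by
      rw [div_le_div_iff₀ hp0 (by linarith), one_mul, ← pow_succ]
      exact hlt'.le
    linarith
  refine ⟨ZMod p, inferInstance, inferInstance, ?_, hprob, ?_⟩
  · rw [Nat.card_zmod]
    exact_mod_cast hle
  · have hpos : 0 < probOptimal k r (ZMod p) T := by
      refine lt_of_lt_of_le ?_ hprob
      rw [sub_pos, div_lt_one (by linarith)]
      linarith
    by_contra! hcon
    have : {H ∈ matricesOn (ZMod p) T | IsOptimalLRC k r (codeOf H)} = ∅ :=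
      Set.eq_empty_iff_forall_notMem.2 fun H h => hcon H h.1 h.2
    simp [probOptimal, this] at hpos

end ParityCheck

/-- A good multigraph leaves room for `d* ≥ 2`. -/
lemma IsGoodMultigraph.exists_dStar_eq {n k r : ℕ} {α β : Type*} {G : Graph α β} (hr : 1 ≤ r)
    (hk₁ : kOne k r ≤ nOne n r) (hG : IsGoodMultigraph n k r G) :
    ∃ t : ℕ, 1 ≤ t ∧ t + k + kOne k r = n + 1 ∧ dStar n k r = ((t + 1 : ℕ) : ℤ) := by
  have := nOne_add_le hr hk₁ hG.nTwo_le_kTwo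
  refine ⟨n + 1 - k - kOne k r, by omega, by omega, ?_⟩
  rw [dStar]; omega

theorem theorem1 (n k r : ℕ) (hr : 1 ≤ r) (hrk : r ≤ k) (hkn : k < n)
    (hk₁ : kOne k r ≤ nOne n r) :
    (IsGreatest (lrcMinDists n k r) (dStar n k r) ↔
      ∃ (α β : Type) (G : Graph α β), IsGoodMultigraph n k r G) ∧
    ∀ (α β : Type*) (G : Graph α β), IsGoodMultigraph n k r G →
      (∃ T : Fin (n - k) → Fin n → Prop, IsFullTannerGraphOf r G T) ∧
      ∀ T : Fin (n - k) → Fin n → Prop, IsFullTannerGraphOf r G T →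
        (∀ (F : Type*) [Field F] [Finite F],
          1 - (n : ℝ) ^ (dStar n k r - 1) / (Nat.card F : ℝ) ≤ probOptimal k r F T) ∧
        (∃ (F : Type) (_ : Field F) (_ : Finite F),
          (Nat.card F : ℝ) ≤ 2 * (n : ℝ) ^ dStar n k r ∧
          1 - 1 / (n : ℝ) ≤ probOptimal k r F T ∧
          ∃ H ∈ matricesOn F T, IsOptimalLRC k r (codeOf H)) := by
  have hk := hr.trans hrk
  refine ⟨⟨?_, ?_⟩, ?_⟩
  · rintro ⟨⟨F, _, _, C, δ, hC, hd, hδ⟩, -⟩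
    exact IsOptimalLRC.exists_good hr hrk hkn ⟨hC, δ, hd, hδ⟩
  · rintro ⟨α, β, G, hG⟩
    obtain ⟨T, hT⟩ := hG.exists_fullTannerGraph hr hk₁
    obtain ⟨t, ht1, ht, -⟩ := hG.exists_dStar_eq hr hk₁
    obtain ⟨F, _, _, -, -, H, -, hC, d, hd, hdd⟩ := hT.exists_field hr hk hkn hk₁ hG ht ht1
    refine ⟨⟨F, _, ‹_›, codeOf H, d, hC, hd, hdd⟩, ?_⟩
    rintro _ ⟨F', _, _, C', δ, hC', hδ, rfl⟩
    have := hC'.singleton_bound hk hr hδ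
    rw [dStar]; omega
  · intro α β G hG
    refine ⟨hG.exists_fullTannerGraph hr hk₁, fun T hT => ?_⟩
    obtain ⟨t, ht1, ht, hdt⟩ := hG.exists_dStar_eq hr hk₁
    refine ⟨?_, ?_⟩
    · intro F _ _
      have h : dStar n k r - 1 = (t : ℤ) := by omega
      rw [h, zpow_natCast]
      exact hT.le_probOptimal hr hk hkn hk₁ hG ht ht1
    · rw [hdt, zpow_natCast]
      exact hT.exists_field hr hk hkn hk₁ hG ht ht1
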